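/- Let $k$ be an algebraically closed field of characteristic $p>3$, let $W_1=\mathrm{Der}_k\big(k[X]/(X^p)\big)$ be the Witt algebra, with the $[p]$-mapping given by the $p$-th power of derivations, and let $D=d/dX$. For $i\ge -1$ let $\mathfrak g_i$ be the $k$-span of the $X^{j+1}D$ with $i\le j\le p-2$. Let $\mathcal N=\{x\in W_1\mid x^{[p]}=0\}$, and for $1\le i\le p-2$ let $$C(i)=\{(x,y)\in\mathcal N\times\mathcal N\mid x\in\mathfrak g_i\setminus\mathfrak g_{i+1},\ [x,y]=0\},\qquad \mathfrak C(i)=\overline{C(i)}$$ (Zariski closure in $W_1\times W_1$). The nilpotent variety $\{x\in\mathscr B^+\mid x^{[p]}=0\}$ of the standard Borel subalgebra $\mathscr B^+=\mathfrak g_0$ is $\mathfrak g_1$. Let $\mathcal C(\mathfrak g_1)=\{(x,y)\in\mathfrak g_1\times\mathfrak g_1\mid [x,y]=0\}$ be its nilpotent commuting variety. Then $$\mathcal C(\mathfrak g_1)=\bigcup_{i=1}^{(p-3)/2}\mathfrak C(i)$$ is the decomposition of $\mathcal C(\mathfrak g_1)$ into irreducible components: the $\mathfrak C(i)$, $1\le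 i\le (p-3)/2$, are pairwise distinct and are exactly the irreducible components. The variety $\mathcal C(\mathfrak g_1)$ is equidimensional: each irreducible component has dimension $p$. In particular $\dim\mathcal C(\mathfrak g_1)=p$. If $p>5$, then $\mathcal C(\mathfrak g_1)$ is reducible. -/

import Mathlib

noncomputable section

namespace WittAlgebra

open Polynomial

/-! ### The Zariski topology on a vector space -/

section Zariski

variable (k : Type*) [Field k] (V : Type*) [AddCommGroup V] [Module k V]

/-- The algebra of polynomial functions on the vector space `V`: the `k`-subalgebra of all
functions `V → k` that is generated by the linear functionals. -/
def polyFun : Subalgebra k (V → k) :=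
  Algebra.adjoin k (Set.range fun φ : V →ₗ[k] k => (φ : V → k))

variable {k V} in
/-- The common zeros in `V` of a set of functions. -/
def commonZeros (S : Set (V → k)) : Set V := {v | ∀ f ∈ S, f v = 0}

/-- The Zariski topology on `V`: the closed sets are the sets of common zeros of
polynomial functions. -/
@[reducible]
def zariski : TopologicalSpace V :=
  TopologicalSpace.ofClosed {Z | ∃ S : Set (V → k), S ⊆ polyFun k V ∧ Z = commonZeros S}
    (by
      refine ⟨{1}, by simp, ?_⟩
      ext v
      simp [commonZeros])
    (by
      intro A hA
      choose S hS hS' using hA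
      refine ⟨⋃ (Z) (hZ : Z ∈ A), S hZ, by simpa using hS, ?_⟩
      ext v
      simp only [Set.mem_sInter, commonZeros, Set.mem_iUnion, Set.mem_ofPred_eq]
      constructor
      · rintro h f ⟨Z, hZ, hf⟩
        have := h Z hZ
        rw [hS' hZ] at this
        exact this f hf
      · intro h Z hZ
        rw [hS' hZ]
        exact fun f hf => h f ⟨Z, hZ, hf⟩)
    (by
      rintro _ ⟨S, hS, rfl⟩ _ ⟨T, hT, rfl⟩
      refine ⟨{h | ∃ f ∈ S, ∃ g ∈ T, h = f * g}, ?_, ?_⟩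
      · rintro _ ⟨f, hf, g, hg, rfl⟩
        exact mul_mem (hS hf) (hT hg)
      · ext v
        simp only [commonZeros, Set.mem_union, Set.mem_ofPred_eq]
        constructor
        · rintro (h | h) _ ⟨f, hf, g, hg, rfl⟩
          · simp [h f hf]
          · simp [h g hg]
        · intro h
          by_contra! hc
          obtain ⟨⟨f, hf, hfv⟩, g, hg, hgv⟩ := hc
          exact mul_ne_zero hfv hgv (h _ ⟨f, hf, g, hg, rfl⟩))

variable {V}

/-- The Zariski topology that a subset `Z` of `V` inherits from `V`. -/
abbrev zariskiOn (Z : Set V) : TopologicalSpace Z :=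
  TopologicalSpace.induced Subtype.val (zariski k V)

/-- The Zariski closure of a subset of `V`. -/
def zariskiClosure (Z : Set V) : Set V := @closure V (zariski k V) Z

/-- A subset of `V` is irreducible (in particular non-empty) for the Zariski topology. -/
def ZariskiIrreducible (Z : Set V) : Prop := @IsIrreducible V (zariski k V) Z

/-- The irreducible components of `Z` with its Zariski topology, as subsets of `V`. -/
def zariskiComponents (Z : Set V) : Set (Set V) :=
  (fun T : Set Z => Subtype.val '' T) '' @irreducibleComponents Z (zariskiOn k Z)

/-- The dimension of `Z` with its Zariski topology. -/
def zariskiDim (Z : Set V) : WithBot ℕ∞ := @topologicalKrullDim Z (zariskiOn k Z)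

end Zariski

/-! ### The Witt algebra -/

section Witt

/-- The truncated polynomial algebra `k[X]/(X ^ p)`. -/
abbrev Trunc (k : Type*) [Field k] (p : ℕ) : Type _ :=
  AdjoinRoot (X ^ p : k[X])

/-- The Witt algebra `W₁`: the Lie algebra of `k`-derivations of `k[X]/(X ^ p)`. -/
abbrev W (k : Type*) [Field k] (p : ℕ) : Type _ := Derivation k (Trunc k p) (Trunc k p)

variable (k : Type*) [Field k] (p : ℕ)

/-- The coset of `X`. -/
def x : Trunc k p := AdjoinRoot.mk _ X

theorem mk_derivative_eq_zero [CharP k p] (f : k[X])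
    (hf : AdjoinRoot.mkₐ (X ^ p : k[X]) f = 0) :
    AdjoinRoot.mkₐ (X ^ p : k[X]) (derivative' f) = 0 := by
  change AdjoinRoot.mk _ f = 0 at hf
  change AdjoinRoot.mk _ (derivative f) = 0
  rw [AdjoinRoot.mk_eq_zero] at hf ⊢
  obtain ⟨g, rfl⟩ := hf
  exact ⟨derivative g, by simp [derivative_mul, derivative_X_pow]⟩

/-- The derivation `D = d/dX` of `k[X]/(X ^ p)`. -/
def D [CharP k p] : W k p :=
  Derivation.liftOfSurjective (f := AdjoinRoot.mkₐ (X ^ p : k[X])) AdjoinRoot.mk_surjective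
    (d := derivative') (mk_derivative_eq_zero k p)

theorem D_x_pow [CharP k p] (i : ℕ) :
    D k p (x k p ^ i) = (i : Trunc k p) * x k p ^ (i - 1) := by
  have h : D k p (x k p) = 1 :=
    (Derivation.liftOfSurjective_apply (f := AdjoinRoot.mkₐ (X ^ p : k[X]))
      AdjoinRoot.mk_surjective
      (mk_derivative_eq_zero k p) X).trans (by simp [derivative'])
  rw [Derivation.leibniz_pow, h]
  simp

/-- The space `𝔤_i` of the filtration of `W₁`: the span of the homogeneous components
`k X ^ (j + 1) D` of degree `j`, over all `-1 ≤ j ≤ p - 2` with `j ≥ i`. -/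
def filtration [CharP k p] (i : ℤ) : Submodule k (W k p) :=
  Submodule.span k {d | ∃ j : ℤ, i ≤ j ∧ -1 ≤ j ∧ j ≤ (p : ℤ) - 2 ∧
    d = x k p ^ (j + 1).toNat • D k p}

theorem x_pow_smul_D_mem [CharP k p] (i : ℕ) (hi : 1 ≤ i) :
    x k p ^ i • D k p ∈ filtration k p 0 := by
  by_cases h : i < p
  · exact Submodule.subset_span ⟨(i : ℤ) - 1, by omega, by omega, by omega, by simp⟩
  · have h0 : x k p ^ p = 0 := by
      rw [x, ← map_pow, AdjoinRoot.mk_self]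
    have : x k p ^ i = 0 := pow_eq_zero_of_le (not_lt.mp h) h0
    simp [this]

/-- The standard Borel subalgebra `ℬ⁺ = 𝔤₀` of `W₁`. -/
def borel [CharP k p] : LieSubalgebra k (W k p) where
  __ := filtration k p 0
  lie_mem' := by
    intro a b ha hb
    change a ∈ filtration k p 0 at ha
    change b ∈ filtration k p 0 at hb
    change ⁅a, b⁆ ∈ filtration k p 0
    unfold filtration at ha
    induction ha using Submodule.span_induction with
    | zero => simp
    | add u v _ _ hu hv => rw [add_lie]; exact add_mem hu hv
    | smul c u _ hu => rw [smul_lie]; exact Submodule.smul_mem _ c hu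
    | mem u hu =>
      unfold filtration at hb
      induction hb using Submodule.span_induction with
      | zero => simp
      | add u v _ _ hu hv => rw [lie_add]; exact add_mem hu hv
      | smul c u _ hu => rw [lie_smul]; exact Submodule.smul_mem _ c hu
      | mem v hv =>
        obtain ⟨i, hi, -, -, rfl⟩ := hu
        obtain ⟨j, hj, -, -, rfl⟩ := hv
        obtain ⟨m, rfl⟩ := Int.eq_ofNat_of_zero_le hi
        obtain ⟨n, rfl⟩ := Int.eq_ofNat_of_zero_le hj
        have hm : ((m : ℤ) + 1).toNat = m + 1 := by omega
        have hn : ((n : ℤ) + 1).toNat = n + 1 := by omega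
        rw [hm, hn]
        have key : ⁅x k p ^ (m + 1) • D k p, x k p ^ (n + 1) • D k p⁆ =
            ((n : k) - m) • (x k p ^ (m + n + 1) • D k p) := by
          ext t
          simp only [Derivation.commutator_apply, Derivation.smul_apply, smul_eq_mul,
            Derivation.leibniz, D_x_pow, Algebra.smul_def, map_sub, map_natCast,
            Nat.add_sub_cancel]
          push_cast
          ring
        rw [key]
        exact Submodule.smul_mem _ _ (x_pow_smul_D_mem k p _ (by omega))

variable {k p}

/-- In characteristic `p`, the `p`-th power of a derivation satisfies the Leibniz rule. -/
theorem pow_char_leibniz {A : Type*} [CommRing A] [Algebra k A] [Fact p.Prime] [CharP k p]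
    (d : Derivation k A A) (a b : A) :
    ((d : Module.End k A) ^ p) (a * b) =
      a • ((d : Module.End k A) ^ p) b + b • ((d : Module.End k A) ^ p) a := by
  let δ : Module.End k A := d
  let L : Module.End k (TensorProduct k A A) := LinearMap.rTensor A δ
  let R : Module.End k (TensorProduct k A A) := LinearMap.lTensor A δ
  have hLR : Commute L R := by
    apply TensorProduct.ext'
    intro u v
    simp [L, R]
  have h1 : ∀ n : ℕ, ∀ t, LinearMap.mul' k A (((L + R) ^ n) t) =
      (δ ^ n) (LinearMap.mul' k A t) := by
    intro n
    induction n with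
    | zero => simp
    | succ n ih =>
      intro t
      rw [pow_succ, pow_succ, Module.End.mul_apply, Module.End.mul_apply, ih]
      congr 1
      induction t using TensorProduct.induction_on with
      | zero => simp
      | add s t hs ht => rw [map_add, map_add, hs, ht, map_add, map_add]
      | tmul u v => simp [L, R, δ, mul_comm, add_comm]
  have hp : ((p : ℕ) : Module.End k (TensorProduct k A A)) = 0 := by
    rw [← map_natCast (algebraMap k (Module.End k (TensorProduct k A A))), CharP.cast_eq_zero,
      map_zero]
  obtain ⟨r, hr⟩ := hLR.exists_add_pow_prime_eq (Fact.out : p.Prime)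
  have h0 : (L + R) ^ p = L ^ p + R ^ p := by
    refine hr.trans ?_
    rw [hp]
    ext
    simp
  have h := h1 p (TensorProduct.tmul k a b)
  have hL : L ^ p = LinearMap.rTensor A (δ ^ p) := LinearMap.rTensor_pow δ p
  have hR : R ^ p = LinearMap.lTensor A (δ ^ p) := LinearMap.lTensor_pow δ p
  rw [h0, hL, hR] at h
  simp only [LinearMap.add_apply, LinearMap.rTensor_tmul, LinearMap.lTensor_tmul, map_add,
    LinearMap.mul'_apply] at h
  change (δ ^ p) (a * b) = a * (δ ^ p) b + b * (δ ^ p) a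
  rw [← h, mul_comm b, add_comm]

/-- The `[p]`-mapping of the restricted Lie algebra `W₁`: the `p`-th power of a derivation. -/
def pMap [Fact p.Prime] [CharP k p] (d : W k p) : W k p :=
  Derivation.mk' ((d : Module.End k (Trunc k p)) ^ p) (pow_char_leibniz d)

/-- The nilpotent variety of a Lie subalgebra `L` of `W₁`: the elements `d` of `L` with
`d^[p] = 0`. -/
def nilpotentVariety [Fact p.Prime] [CharP k p] (L : LieSubalgebra k (W k p)) : Set (W k p) :=
  {d | d ∈ L ∧ pMap d = 0}

/-- The pairs of commuting elements of a subset `N` of `W₁`. -/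
def commutingVariety (N : Set (W k p)) : Set (W k p × W k p) :=
  {q | q.1 ∈ N ∧ q.2 ∈ N ∧ ⁅q.1, q.2⁆ = 0}

variable (k p)

/-- `C(i)`, for `1 ≤ i ≤ p - 2`: the commuting pairs of elements of the nilpotent variety of `W₁`
whose first entry lies in `𝔤_i` but not in `𝔤_{i+1}`. -/
def stratum [Fact p.Prime] [CharP k p] (i : ℕ) : Set (W k p × W k p) :=
  {q | q ∈ commutingVariety (nilpotentVariety (⊤ : LieSubalgebra k (W k p))) ∧
    q.1 ∈ filtration k p i ∧ q.1 ∉ filtration k p (i + 1)}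

/-- `ℭ(i)`, the Zariski closure of `C(i)`. -/
def frakC [Fact p.Prime] [CharP k p] (i : ℕ) : Set (W k p × W k p) :=
  zariskiClosure k (stratum k p i)

end Witt

end WittAlgebra

end

/-! Write a derivation as `t • D`; it lies in `𝔤_i` exactly when `X ^ (i + 1)` divides `t`. If `d`
has leading term `a X ^ m D` and `e` has leading term `b X ^ n D`, then `⁅d, e⁆` begins with `(n -
m) a b X ^ (m + n - 1) D`. Hence an `e` commuting with `d ∈ 𝔤_i ∖ 𝔤_{i+1}` has, after subtracting a
multiple of `d`, no term below degree `p - 1 - i`: the centralizer is `k d + 𝔤_{p-1-i}`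
(`exists_sub_smul_mem_of_lie_eq_zero`, `lie_eq_zero_of_mem`). For `i ≥ 1` this consists of nilpotent
elements, so `ℭ(i)` is the closure of the image of the polynomial map `(d, c, e) ↦ (d, c d + e)` on
`𝔤_i × k × 𝔤_{p-1-i}`, a vector space of dimension `(p - 1 - i) + 1 + i = p`. This makes `ℭ(i)`
irreducible and bounds its dimension by `p`. Equality holds because, for `i ≤ (p - 3) / 2`, it
strictly contains the linear space `𝔤_i × 𝔤_{p-1-i}` of dimension `p - 1`.

The strata with `i` from `(p - 1) / 2` on contribute nothing new: their pairs are limits along lines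
of pairs from lower strata (`mk_mem_of_paramSet_subset`). The remaining `ℭ(i)` are incomparable
(`eq_of_frakC_subset`): the order of the first entry separates them in one direction, and a `2 × 2`
minor in the other. -/

namespace WittAlgebra

open Topology Set

/-! ### Irreducible components and Krull dimension in a general topological space. -/

section Components

variable {X ι : Type*} [TopologicalSpace X]

/-- An irreducible set covered by a finite family of closed sets lies in one of them. -/
theorem exists_subset_of_isIrreducible {T : Set X} (hT : IsIrreducible T) {s : Set ι}
    (hs : s.Finite) {F : ι → Set X} (hF : ∀ i ∈ s, IsClosed (F i)) (h : T ⊆ ⋃ i ∈ s, F i) :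
    ∃ i ∈ s, T ⊆ F i := by
  have := isIrreducible_iff_sUnion_isClosed.mp hT (hs.toFinset.image F)
    (by simpa using hF) (by simpa [Set.sUnion_image] using h)
  simpa using this

/-- An irreducible subset of `Z` is irreducible in the subspace topology of `Z`. -/
theorem isIrreducible_preimage_val {Z F : Set X} (hF : IsIrreducible F) (h : F ⊆ Z) :
    IsIrreducible (Subtype.val ⁻¹' F : Set Z) := by
  refine ⟨?_, fun U V hU hV hFU hFV => ?_⟩
  · obtain ⟨x, hx⟩ := hF.1
    exact ⟨⟨x, h hx⟩, hx⟩
  · obtain ⟨U', hU', rfl⟩ := isOpen_induced_iff.mp hU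
    obtain ⟨V', hV', rfl⟩ := isOpen_induced_iff.mp hV
    obtain ⟨x, hx, hx'⟩ := hFU
    obtain ⟨y, hy, hy'⟩ := hFV
    obtain ⟨z, hz, hz'⟩ := hF.2 U' V' hU' hV' ⟨x, hx, hx'⟩ ⟨y, hy, hy'⟩
    exact ⟨⟨z, h hz⟩, hz, hz'⟩

/-- The irreducible components of a finite irredundant union of closed irreducible sets. -/
theorem image_irreducibleComponents_eq {s : Set ι} (hs : s.Finite) {F : ι → Set X}
    (hF : ∀ i ∈ s, IsClosed (F i)) (hF' : ∀ i ∈ s, IsIrreducible (F i))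
    (hinj : ∀ i ∈ s, ∀ j ∈ s, F i ⊆ F j → i = j) {Z : Set X} (hZ : Z = ⋃ i ∈ s, F i) :
    (fun T : Set Z => Subtype.val '' T) '' irreducibleComponents Z = F '' s := by
  have hsub : ∀ i ∈ s, F i ⊆ Z := fun i hi => hZ ▸ subset_biUnion_of_mem hi
  have hirr : ∀ i ∈ s, IsIrreducible (Subtype.val ⁻¹' F i : Set Z) := fun i hi =>
    isIrreducible_preimage_val (hF' i hi) (hsub i hi)
  have himage : ∀ i ∈ s, Subtype.val '' (Subtype.val ⁻¹' F i : Set Z) = F i := by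
    intro i hi
    rw [Subtype.image_preimage_coe, inter_eq_right]
    exact hsub i hi
  have hcover : ∀ T : Set Z, IsIrreducible T → ∃ i ∈ s, T ⊆ Subtype.val ⁻¹' F i := by
    intro T hT
    obtain ⟨i, hi, h⟩ := exists_subset_of_isIrreducible
      (hT.image Subtype.val continuous_subtype_val.continuousOn) hs hF (by
        rintro _ ⟨x, -, rfl⟩
        exact hZ ▸ x.2)
    exact ⟨i, hi, image_subset_iff.mp h⟩
  ext T
  constructor
  · rintro ⟨T, hT, rfl⟩
    obtain ⟨i, hi, h⟩ := hcover T hT.1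
    refine ⟨i, hi, ?_⟩
    have : T = Subtype.val ⁻¹' F i := h.antisymm (hT.2 (hirr i hi) h)
    simp only
    rw [this, himage i hi]
  · rintro ⟨i, hi, rfl⟩
    refine ⟨_, ⟨hirr i hi, fun T hT h => ?_⟩, himage i hi⟩
    obtain ⟨j, hj, h'⟩ := hcover T hT
    have : i = j := hinj i hi j hj (by
      rw [← himage i hi, ← himage j hj]
      exact image_mono (h.trans h'))
    exact this ▸ h'

/-- A strictly increasing chain of closed irreducible subsets bounds the dimension from below. -/
theorem le_topologicalKrullDim {Z : Set X} {n : ℕ} (f : Fin (n + 1) → Set X) (hf : StrictMono f)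
    (hc : ∀ j, IsClosed (f j)) (hi : ∀ j, IsIrreducible (f j)) (hZ : ∀ j, f j ⊆ Z) :
    (n : WithBot ℕ∞) ≤ topologicalKrullDim Z := by
  let g : Fin (n + 1) → TopologicalSpace.IrreducibleCloseds Z := fun j =>
    { carrier := Subtype.val ⁻¹' f j
      isIrreducible' := isIrreducible_preimage_val (hi j) (hZ j)
      isClosed' := (hc j).preimage continuous_subtype_val }
  have hg : StrictMono g := by
    intro a b hab
    have h := hf hab
    refine lt_of_le_of_ne (fun x hx => h.le hx) fun he => h.not_ge fun x hx => ?_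
    have : (⟨x, hZ b hx⟩ : Z) ∈ g a := he ▸ hx
    exact this
  exact Order.LTSeries.length_le_krullDim (LTSeries.mk n g hg)

/-- A strictly monotone, bounded function on the closed irreducible subsets of a closed set bounds
its dimension from above. -/
theorem topologicalKrullDim_le {Z : Set X} (hZ : IsClosed Z) {n : ℕ} (r : Set X → ℕ)
    (hr : ∀ S T : Set X, IsClosed S → IsIrreducible S → IsClosed T → IsIrreducible T → S ⊂ T →
      T ⊆ Z → r S < r T)
    (hn : ∀ T : Set X, IsClosed T → IsIrreducible T → T ⊆ Z → r T ≤ n) :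
    topologicalKrullDim Z ≤ n := by
  refine iSup_le fun l => ?_
  have hsub : ∀ T : TopologicalSpace.IrreducibleCloseds Z,
      ((TopologicalSpace.IrreducibleCloseds.map Subtype.val continuous_subtype_val T :
        TopologicalSpace.IrreducibleCloseds X) : Set X) ⊆ Z := fun T =>
    closure_minimal (by rintro _ ⟨x, -, rfl⟩; exact x.2) hZ
  let g : TopologicalSpace.IrreducibleCloseds Z → ℕ := fun T =>
    r (TopologicalSpace.IrreducibleCloseds.map Subtype.val continuous_subtype_val T :
      TopologicalSpace.IrreducibleCloseds X)
  have hg : StrictMono g := by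
    intro S T hST
    have := TopologicalSpace.IrreducibleCloseds.map_strictMono_of_isInducing
      (IsInducing.subtypeVal (t := Z)) hST
    exact hr _ _ (TopologicalSpace.IrreducibleCloseds.isClosed _)
      (TopologicalSpace.IrreducibleCloseds.isIrreducible _)
      (TopologicalSpace.IrreducibleCloseds.isClosed _)
      (TopologicalSpace.IrreducibleCloseds.isIrreducible _) this (hsub T)
  -- A strictly increasing sequence of natural numbers dominates its index, so the value of `r` at
  -- the top of the chain bounds its length.
  have hl : ∀ j : ℕ, (hj : j < l.length + 1) → j ≤ g (l ⟨j, hj⟩) := by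
    intro j
    induction j with
    | zero => simp
    | succ j ih =>
      intro hj
      exact (ih (by omega)).trans_lt (hg (l.strictMono (by simp)))
  have h1 := hl l.length (by omega)
  have h2 : g (l ⟨l.length, by omega⟩) ≤ n :=
    hn _ (TopologicalSpace.IrreducibleCloseds.isClosed _)
      (TopologicalSpace.IrreducibleCloseds.isIrreducible _) (hsub _)
  exact_mod_cast h1.trans h2

end Components

/-! ### Transcendence degree under surjections of domains. -/

/-- The transcendence degree drops strictly under a non-injective surjection of domains. -/
theorem trdeg_lt_of_surjective.{v} {k : Type*} [Field k] {A B : Type v} [CommRing A] [IsDomain A]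
    [Algebra k A] [CommRing B] [IsDomain B] [Algebra k B] (f : A →ₐ[k] B)
    (hf : Function.Surjective f) {a : A} (ha : a ≠ 0) (hfa : f a = 0) {n : ℕ}
    (hn : Algebra.trdeg k A ≤ n) :
    Cardinal.toNat (Algebra.trdeg k B) < Cardinal.toNat (Algebra.trdeg k A) := by
  obtain ⟨s, hs⟩ := exists_isTranscendenceBasis k B
  have hAfin : Algebra.trdeg k A < Cardinal.aleph0 := hn.trans_lt (Cardinal.natCast_lt_aleph0)
  let y : s → A := fun i => Function.surjInv hf i
  have hy : f ∘ y = Subtype.val := funext fun i => Function.surjInv_eq hf i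
  have hyi : AlgebraicIndependent k y := by
    have := hs.1
    rw [← hy] at this
    exact AlgebraicIndependent.of_comp f this
  have hle := hyi.cardinalMk_le_trdeg
  have hsB := hs.cardinalMk_eq_trdeg
  have hsfin : Finite s := Cardinal.lt_aleph0_iff_finite.mp (hle.trans_lt hAfin)
  -- If the degree did not drop, the lift `y` of a transcendence basis of `B` would be one of `A`.
  -- Then `a` would divide a nonzero polynomial in `y`, which `f` kills along with `a`, against the
  -- independence of `s`.
  by_contra hcon
  push Not at hcon
  have hle' : Algebra.trdeg k A ≤ Cardinal.mk s := by
    rw [← Cardinal.cast_toNat_of_lt_aleph0 (c := Algebra.trdeg k A) hAfin]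
    rw [← hsB] at hcon
    rw [← Cardinal.cast_toNat_of_lt_aleph0 (hle.trans_lt hAfin)]
    exact_mod_cast hcon
  have hyb := hyi.isTranscendenceBasis_of_trdeg_le_of_finite hle'
  have halg := hyb.isAlgebraic
  obtain ⟨r, hr, c, hc⟩ := (halg.isAlgebraic a).exists_nonzero_dvd (by simpa using ha)
  obtain ⟨q, hq⟩ : ∃ q : MvPolynomial s k, MvPolynomial.aeval y q = (r : A) := by
    have h : (r : A) ∈ (MvPolynomial.aeval (R := k) y).range :=
      Algebra.adjoin_range_eq_range_aeval k y ▸ r.2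
    exact h
  have h0 : MvPolynomial.aeval (f ∘ y) q = 0 := by
    have : f (MvPolynomial.aeval y q) = 0 := by
      rw [hq]
      change (r : A) = a * c at hc
      rw [hc, map_mul, hfa, zero_mul]
    rw [← this, ← AlgHom.comp_apply, MvPolynomial.comp_aeval]
    rfl
  rw [hy] at h0
  have hq0 : q = 0 := by
    apply hs.1
    rw [h0, map_zero]
  apply hr
  ext
  rw [← hq, hq0]
  simp

/-! ### Polynomial functions and polynomial maps for the Zariski topology. -/

section Zariski

variable {k : Type*} [Field k] {V V' E : Type*} [AddCommGroup V] [Module k V]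
  [AddCommGroup V'] [Module k V'] [AddCommGroup E] [Module k E]

theorem isClosed_zariski_iff {Z : Set V} :
    IsClosed[zariski k V] Z ↔ ∃ S : Set (V → k), S ⊆ polyFun k V ∧ Z = commonZeros S := by
  rw [← @isOpen_compl_iff V Z (zariski k V)]
  change Zᶜᶜ ∈ {Z | ∃ S : Set (V → k), S ⊆ polyFun k V ∧ Z = commonZeros S} ↔ _
  rw [compl_compl]
  rfl

theorem linear_mem_polyFun (φ : V →ₗ[k] k) : (φ : V → k) ∈ polyFun k V :=
  Algebra.subset_adjoin ⟨φ, rfl⟩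

theorem isClosed_zeros {f : V → k} (hf : f ∈ polyFun k V) :
    IsClosed[zariski k V] {v | f v = 0} :=
  isClosed_zariski_iff.mpr ⟨{f}, by simpa using hf, by ext; simp [commonZeros]⟩

theorem isClosed_submodule (L : Submodule k V) : IsClosed[zariski k V] (L : Set V) := by
  refine isClosed_zariski_iff.mpr
    ⟨{f | ∃ φ : V →ₗ[k] k, L ≤ LinearMap.ker φ ∧ f = φ}, ?_, ?_⟩
  · rintro _ ⟨φ, -, rfl⟩
    exact linear_mem_polyFun φ
  · ext v
    constructor
    · rintro hv _ ⟨φ, hφ, rfl⟩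
      exact hφ hv
    · intro h
      by_contra hv
      obtain ⟨φ, hφ, hL⟩ := Submodule.exists_le_ker_of_notMem hv
      exact hφ (h _ ⟨φ, hL, rfl⟩)

/-- A point outside a closed set is detected by a polynomial function. -/
theorem exists_polyFun_ne_zero {Z : Set V} (hZ : IsClosed[zariski k V] Z) {v : V} (hv : v ∉ Z) :
    ∃ f ∈ polyFun k V, (∀ z ∈ Z, f z = 0) ∧ f v ≠ 0 := by
  obtain ⟨S, hS, rfl⟩ := isClosed_zariski_iff.mp hZ
  simp only [commonZeros, mem_ofPred_eq, not_forall] at hv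
  obtain ⟨f, hf, hfv⟩ := hv
  exact ⟨f, hS hf, fun z hz => hz f hf, hfv⟩

/-- A closed set contains a point as soon as it contains the rest of a line through it. -/
theorem mem_of_forall_ne_zero [Infinite k] {Z : Set V} (hZ : IsClosed[zariski k V] Z) {q u : V}
    (h : ∀ t : k, t ≠ 0 → q + t • u ∈ Z) : q ∈ Z := by
  by_contra hq
  obtain ⟨f, hf, hfZ, hfq⟩ := exists_polyFun_ne_zero hZ hq
  -- Restricted to a line, a polynomial function is a polynomial in one variable; this one has every
  -- nonzero `t` as a root.
  have hP : ∃ P : Polynomial k, ∀ t, P.eval t = f (q + t • u) := by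
    clear hfZ hfq
    induction hf using Algebra.adjoin_induction with
    | mem g hg =>
      obtain ⟨φ, rfl⟩ := hg
      exact ⟨.C (φ q) + .X * .C (φ u), fun t => by simp [mul_comm t]⟩
    | algebraMap c => exact ⟨.C c, fun t => by simp⟩
    | add g g' _ _ hg hg' =>
      obtain ⟨P, hP⟩ := hg
      obtain ⟨P', hP'⟩ := hg'
      exact ⟨P + P', fun t => by simp [hP, hP']⟩
    | mul g g' _ _ hg hg' =>
      obtain ⟨P, hP⟩ := hg
      obtain ⟨P', hP'⟩ := hg'
      exact ⟨P * P', fun t => by simp [hP, hP']⟩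
  obtain ⟨P, hP⟩ := hP
  have h0 : P = 0 := Polynomial.eq_zero_of_infinite_isRoot P
    (((Set.finite_singleton (0 : k)).infinite_compl).mono fun t ht => by
      rw [mem_ofPred_eq, Polynomial.IsRoot, hP]
      exact hfZ _ (h t ht))
  apply hfq
  simpa [h0] using (hP 0).symm

/-- A map between vector spaces is polynomial if its components are. -/
def IsPolyMap (k : Type*) [Field k] {E V : Type*} [AddCommGroup E] [Module k E] [AddCommGroup V]
    [Module k V] (φ : E → V) : Prop :=
  ∀ l : V →ₗ[k] k, (fun e => l (φ e)) ∈ polyFun k E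

theorem IsPolyMap.comp_mem {φ : E → V} (hφ : IsPolyMap k φ) {f : V → k} (hf : f ∈ polyFun k V) :
    (fun e => f (φ e)) ∈ polyFun k E := by
  induction hf using Algebra.adjoin_induction with
  | mem g hg =>
    obtain ⟨l, rfl⟩ := hg
    exact hφ l
  | algebraMap c => exact (polyFun k E).algebraMap_mem c
  | add g g' _ _ hg hg' => exact add_mem hg hg'
  | mul g g' _ _ hg hg' => exact mul_mem hg hg'

theorem IsPolyMap.continuous {φ : E → V} (hφ : IsPolyMap k φ) :
    Continuous[zariski k E, zariski k V] φ := by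
  let _ := zariski k E
  let _ := zariski k V
  refine continuous_iff_isClosed.mpr fun Z hZ => ?_
  obtain ⟨S, hS, rfl⟩ := isClosed_zariski_iff.mp hZ
  refine isClosed_zariski_iff.mpr ⟨(fun f e => f (φ e)) '' S, ?_, ?_⟩
  · rintro _ ⟨f, hf, rfl⟩
    exact hφ.comp_mem (hS hf)
  · ext e
    simp [commonZeros]

theorem isPolyMap_linear (φ : E →ₗ[k] V) : IsPolyMap k φ := fun l =>
  linear_mem_polyFun (l ∘ₗ φ)

theorem IsPolyMap.add {φ ψ : E → V} (hφ : IsPolyMap k φ) (hψ : IsPolyMap k ψ) :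
    IsPolyMap k fun e => φ e + ψ e := fun l => by
  simpa using! add_mem (hφ l) (hψ l)

theorem IsPolyMap.prodMk {φ : E → V} {ψ : E → V'} (hφ : IsPolyMap k φ) (hψ : IsPolyMap k ψ) :
    IsPolyMap k fun e => (φ e, ψ e) := fun l => by
  have h := add_mem (hφ (l ∘ₗ LinearMap.inl k V V')) (hψ (l ∘ₗ LinearMap.inr k V V'))
  convert! h using 1
  ext e
  simp [← map_add]

theorem IsPolyMap.bilinear {V'' : Type*} [AddCommGroup V''] [Module k V''] [FiniteDimensional k V]
    (B : V →ₗ[k] V' →ₗ[k] V'') {φ : E → V} {ψ : E → V'} (hφ : IsPolyMap k φ)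
    (hψ : IsPolyMap k ψ) : IsPolyMap k fun e => B (φ e) (ψ e) := fun l => by
  let b := Module.finBasis k V
  have h : (fun e => l (B (φ e) (ψ e))) =
      ∑ i, (fun e => b.coord i (φ e)) * fun e => (l ∘ₗ B (b i)) (ψ e) := by
    ext e
    conv_lhs => rw [← b.sum_repr (φ e)]
    simp only [map_sum, map_smul, LinearMap.sum_apply, LinearMap.smul_apply]
    simp
  rw [h]
  exact sum_mem fun i _ => mul_mem (hφ _) (hψ _)

/-- The polynomial functions as polynomials in coordinates. -/
theorem exists_mvPolynomial {ι : Type*} [Fintype ι] (b : Module.Basis ι k E) {f : E → k}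
    (hf : f ∈ polyFun k E) :
    ∃ P : MvPolynomial ι k, ∀ e, f e = MvPolynomial.eval (b.repr e) P := by
  induction hf using Algebra.adjoin_induction with
  | mem g hg =>
    obtain ⟨φ, rfl⟩ := hg
    refine ⟨∑ i, .X i * .C (φ (b i)), fun e => ?_⟩
    conv_lhs => rw [← b.sum_repr e]
    simp only [map_sum, map_smul]
    simp
  | algebraMap c => exact ⟨.C c, fun t => by simp⟩
  | add g g' _ _ hg hg' =>
    obtain ⟨P, hP⟩ := hg
    obtain ⟨P', hP'⟩ := hg'
    exact ⟨P + P', fun t => by simp [hP, hP']⟩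
  | mul g g' _ _ hg hg' =>
    obtain ⟨P, hP⟩ := hg
    obtain ⟨P', hP'⟩ := hg'
    exact ⟨P * P', fun t => by simp [hP, hP']⟩

/-- Two nonempty open sets contain the nonvanishing loci of nonzero polynomials `P` and `Q`; over an
infinite field the nonzero polynomial `P * Q` does not vanish identically. -/
theorem isIrreducible_univ_zariski [Infinite k] [FiniteDimensional k E] :
    @IsIrreducible E (zariski k E) univ := by
  let _ := zariski k E
  refine ⟨⟨0, trivial⟩, fun U V hU hV ⟨u, _, hu⟩ ⟨v, _, hv⟩ => ?_⟩
  obtain ⟨f, hf, hfU, hfu⟩ := exists_polyFun_ne_zero hU.isClosed_compl (not_not_intro hu)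
  obtain ⟨g, hg, hgV, hgv⟩ := exists_polyFun_ne_zero hV.isClosed_compl (not_not_intro hv)
  let b := Module.finBasis k E
  obtain ⟨P, hP⟩ := exists_mvPolynomial b hf
  obtain ⟨Q, hQ⟩ := exists_mvPolynomial b hg
  have hP0 : P ≠ 0 := by
    rintro rfl
    exact hfu (by simp [hP])
  have hQ0 : Q ≠ 0 := by
    rintro rfl
    exact hgv (by simp [hQ])
  by_contra hne
  refine mul_ne_zero hP0 hQ0 (MvPolynomial.funext fun a => ?_)
  obtain ⟨e, rfl⟩ : ∃ e, ⇑(b.repr e) = a :=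
    ⟨b.equivFun.symm a, by rw [← b.equivFun_apply, LinearEquiv.apply_symm_apply]⟩
  rw [map_mul, ← hP, ← hQ, map_zero, mul_eq_zero]
  by_contra! hfg
  exact hne ⟨e, trivial, by_contra fun h => hfg.1 (hfU e h), by_contra fun h => hfg.2 (hgV e h)⟩

theorem IsPolyMap.isIrreducible_range [Infinite k] [FiniteDimensional k E] {φ : E → V}
    (hφ : IsPolyMap k φ) : @IsIrreducible V (zariski k V) (range φ) := by
  let _ := zariski k E
  let _ := zariski k V
  rw [← image_univ]
  exact isIrreducible_univ_zariski.image φ hφ.continuous.continuousOn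

theorem isIrreducible_submodule [Infinite k] (L : Submodule k V) [FiniteDimensional k L] :
    @IsIrreducible V (zariski k V) (L : Set V) := by
  simpa using (isPolyMap_linear L.subtype).isIrreducible_range

/-! ### Coordinate rings and dimension -/

/-- Restriction of functions to a subset. -/
def restrictHom (k : Type*) [Field k] {V : Type*} {S T : Set V} (h : S ⊆ T) :
    (T → k) →ₐ[k] (S → k) :=
  AlgHom.pi fun s => Pi.evalAlgHom k _ (⟨s, h s.2⟩ : T)

variable (k) in
/-- The ring of polynomial functions on a subset of a vector space. -/
def coordRing (T : Set V) : Subalgebra k (T → k) :=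
  (polyFun k V).map (AlgHom.pi fun t : T => Pi.evalAlgHom k _ (t : V))

theorem mem_coordRing {T : Set V} {f : T → k} :
    f ∈ coordRing k T ↔ ∃ g ∈ polyFun k V, ∀ t : T, g t = f t := by
  constructor
  · rintro ⟨g, hg, rfl⟩
    exact ⟨g, hg, fun t => rfl⟩
  · rintro ⟨g, hg, h⟩
    exact ⟨g, hg, funext h⟩

theorem exists_surjective_coordRing {S T : Set V} (h : S ⊆ T) :
    ∃ r : coordRing k T →ₐ[k] coordRing k S, Function.Surjective r ∧
      ∀ f (s : S), (r f : S → k) s = (f : T → k) ⟨s, h s.2⟩ := by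
  refine ⟨((restrictHom k h).comp (coordRing k T).val).codRestrict _ ?_, ?_, ?_⟩
  · rintro ⟨f, hf⟩
    obtain ⟨g, hg, hgf⟩ := mem_coordRing.mp hf
    exact mem_coordRing.mpr ⟨g, hg, fun s => hgf ⟨s, h s.2⟩⟩
  · rintro ⟨f, hf⟩
    obtain ⟨g, hg, hgf⟩ := mem_coordRing.mp hf
    exact ⟨⟨fun t => g t, mem_coordRing.mpr ⟨g, hg, fun _ => rfl⟩⟩, Subtype.ext (funext hgf)⟩
  · exact fun f s => rfl

theorem isDomain_coordRing {T : Set V} (hT : @IsIrreducible V (zariski k V) T) :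
    IsDomain (coordRing k T) := by
  let _ := zariski k V
  obtain ⟨⟨t, ht⟩, hT'⟩ := hT
  have : Nontrivial (coordRing k T) := ⟨0, 1, fun h =>
    zero_ne_one (congrFun (congrArg Subtype.val h) ⟨t, ht⟩ : (0 : k) = 1)⟩
  have : NoZeroDivisors (coordRing k T) := by
    refine ⟨fun {a b} hab => ?_⟩
    obtain ⟨f, hf, hfa⟩ := mem_coordRing.mp a.2
    obtain ⟨g, hg, hgb⟩ := mem_coordRing.mp b.2
    have hcov := isPreirreducible_iff_isClosed_union_isClosed.mp hT' _ _
      (isClosed_zeros hf) (isClosed_zeros hg) fun t ht => by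
        have : (a : T → k) ⟨t, ht⟩ * (b : T → k) ⟨t, ht⟩ = 0 :=
          congrFun (congrArg Subtype.val hab) ⟨t, ht⟩
        rw [← hfa, ← hgb] at this
        exact mul_eq_zero.mp this
    refine hcov.imp (fun h => ?_) fun h => ?_
    · exact Subtype.ext (funext fun t => (hfa t).symm.trans (h t.2))
    · exact Subtype.ext (funext fun t => (hgb t).symm.trans (h t.2))
  exact NoZeroDivisors.to_isDomain _

theorem trdeg_coordRing_mono {S T : Set V} (h : S ⊆ T) :
    Algebra.trdeg k (coordRing k S) ≤ Algebra.trdeg k (coordRing k T) := by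
  obtain ⟨r, hr, -⟩ := exists_surjective_coordRing (k := k) h
  exact trdeg_le_of_surjective r hr

/-- A polynomial function vanishing on `S` but not on `T` is a nonzero element of the kernel of
restriction. This makes the transcendence degree a strictly monotone rank, as
`topologicalKrullDim_le` requires. -/
theorem trdeg_coordRing_lt {S T : Set V} (hSc : IsClosed[zariski k V] S)
    (hS : @IsIrreducible V (zariski k V) S) (hT : @IsIrreducible V (zariski k V) T) (h : S ⊂ T)
    {n : ℕ} (hn : Algebra.trdeg k (coordRing k T) ≤ n) :
    Cardinal.toNat (Algebra.trdeg k (coordRing k S)) <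
      Cardinal.toNat (Algebra.trdeg k (coordRing k T)) := by
  have := isDomain_coordRing hS
  have := isDomain_coordRing hT
  obtain ⟨r, hr, hr'⟩ := exists_surjective_coordRing (k := k) h.subset
  obtain ⟨t, ht, hts⟩ := Set.exists_of_ssubset h
  obtain ⟨f, hf, hfS, hft⟩ := exists_polyFun_ne_zero hSc hts
  let a : coordRing k T := ⟨fun t => f t, mem_coordRing.mpr ⟨f, hf, fun _ => rfl⟩⟩
  refine trdeg_lt_of_surjective r hr (a := a) (fun h0 => hft ?_) ?_ hn
  · exact congrFun (congrArg Subtype.val h0) ⟨t, ht⟩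
  · exact Subtype.ext (funext fun s => (hr' a s).trans (hfS s s.2))

/-- The closure of a set that is parametrized by an `n`-dimensional vector space has
transcendence degree at most `n`. -/
theorem trdeg_coordRing_closure_le [Infinite k] [FiniteDimensional k E] {φ : E → V}
    (hφ : IsPolyMap k φ) {T : Set V} (hT : T ⊆ zariskiClosure k (range φ)) (hφT : range φ ⊆ T) :
    Algebra.trdeg k (coordRing k T) ≤ Module.finrank k E := by
  let b := Module.finBasis k E
  let ev : MvPolynomial (Fin (Module.finrank k E)) k →ₐ[k] (E → k) :=
    AlgHom.pi fun e => MvPolynomial.aeval (b.repr e)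
  have hev : Function.Injective ev := by
    rw [injective_iff_map_eq_zero]
    intro P hP
    refine MvPolynomial.funext fun a => ?_
    have := congrFun hP (b.equivFun.symm a)
    have hb : ⇑(b.repr (b.equivFun.symm a)) = a := by
      rw [← b.equivFun_apply, LinearEquiv.apply_symm_apply]
    rw [map_zero, ← hb]
    simpa only [ev, AlgHom.pi_apply, MvPolynomial.aeval_eq_eval] using! this
  let pb : coordRing k T →ₐ[k] (E → k) :=
    (AlgHom.pi fun e => Pi.evalAlgHom k _ (⟨φ e, hφT ⟨e, rfl⟩⟩ : T)).comp
      (coordRing k T).val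
  -- A function that pulls back to zero vanishes on the image of `φ`, hence on its closure. So the
  -- coordinate ring embeds into a polynomial ring in `finrank k E` variables.
  have hpb : Function.Injective pb := by
    rw [injective_iff_map_eq_zero]
    intro a ha
    obtain ⟨f, hf, hfa⟩ := mem_coordRing.mp a.2
    let _ := zariski k V
    have h : T ⊆ {v | f v = 0} := hT.trans <| closure_minimal (by
      rintro _ ⟨e, rfl⟩
      exact (hfa ⟨φ e, hφT ⟨e, rfl⟩⟩).trans (congrFun ha e)) (isClosed_zeros hf)
    exact Subtype.ext (funext fun t => (hfa t).symm.trans (h t.2))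
  have hrange : ∀ a, pb a ∈ ev.range := by
    intro a
    obtain ⟨f, hf, hfa⟩ := mem_coordRing.mp a.2
    obtain ⟨P, hP⟩ := exists_mvPolynomial b (hφ.comp_mem hf)
    exact ⟨P, funext fun e => ((hfa ⟨φ e, hφT ⟨e, rfl⟩⟩).symm.trans (hP e)).symm⟩
  have h1 := lift_trdeg_le_of_injective
    ((AlgEquiv.ofInjective ev hev).symm.toAlgHom.comp (pb.codRestrict ev.range hrange))
    ((AlgEquiv.ofInjective ev hev).symm.injective.comp
      fun x y hxy => hpb (congrArg Subtype.val hxy))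
  rw [MvPolynomial.trdeg_of_isDomain] at h1
  simpa using h1

theorem zariskiDim_le {ι : Type*} {s : Set ι} (hs : s.Finite) {F : ι → Set V}
    (hF : ∀ i ∈ s, IsClosed[zariski k V] (F i)) {n : ℕ}
    (hn : ∀ i ∈ s, Algebra.trdeg k (coordRing k (F i)) ≤ n) {Z : Set V}
    (hZ : IsClosed[zariski k V] Z) (hZF : Z ⊆ ⋃ i ∈ s, F i) : zariskiDim k Z ≤ n := by
  let _ := zariski k V
  have hle : ∀ T : Set V, IsIrreducible T → T ⊆ Z → Algebra.trdeg k (coordRing k T) ≤ n := by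
    intro T hT hTZ
    obtain ⟨i, hi, h⟩ := exists_subset_of_isIrreducible hT hs hF (hTZ.trans hZF)
    exact (trdeg_coordRing_mono h).trans (hn i hi)
  exact topologicalKrullDim_le hZ (fun T => Cardinal.toNat (Algebra.trdeg k (coordRing k T)))
    (fun S T hSc hS _ hT h hTZ => trdeg_coordRing_lt hSc hS hT h (hle T hT hTZ))
    (fun T _ hT hTZ => by
      simpa using Cardinal.toNat_le_toNat (hle T hT hTZ) (Cardinal.natCast_lt_aleph0))

/-- A closed irreducible set that strictly contains a linear subspace of dimension `n` has
dimension at least `n + 1`. -/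
theorem le_zariskiDim [Infinite k] (L : Submodule k V) [FiniteDimensional k L] {T Z : Set V}
    (hTc : IsClosed[zariski k V] T) (hT : @IsIrreducible V (zariski k V) T) (hLT : (L : Set V) ⊂ T)
    (hTZ : T ⊆ Z) : ((Module.finrank k L + 1 : ℕ) : WithBot ℕ∞) ≤ zariskiDim k Z := by
  let _ := zariski k V
  let b := Module.finBasis k L
  let G : Fin (Module.finrank k L + 1) → Submodule k V := fun j => (b.flag j).map L.subtype
  have hG : StrictMono G := (Submodule.map_strictMono_of_injective L.injective_subtype).comp
    b.flag_strictMono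
  have hGL : ∀ j, G j ≤ L := fun j => Submodule.map_subtype_le L _
  have hGfin : ∀ j, FiniteDimensional k (G j) := fun j =>
    Submodule.finiteDimensional_of_le (hGL j)
  -- A full flag of subspaces of `L`, with `T` placed on top, gives a chain of length `finrank k L +
  -- 1`.
  let f : Fin (Module.finrank k L + 1 + 1) → Set V :=
    Fin.snoc (α := fun _ => Set V) (fun j => (G j : Set V)) T
  refine le_topologicalKrullDim f ?_ ?_ ?_ ?_
  · refine Fin.strictMono_iff_lt_succ.mpr fun j => ?_
    induction j using Fin.lastCases with
    | last =>
      simp only [f, Fin.snoc_castSucc, Fin.succ_last, Fin.snoc_last]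
      exact lt_of_le_of_lt (hGL _) hLT
    | cast j =>
      rw [Fin.succ_castSucc]
      simp only [f, Fin.snoc_castSucc]
      exact hG Fin.castSucc_lt_succ
  · intro j
    induction j using Fin.lastCases with
    | last => simpa [f] using hTc
    | cast j => simpa [f] using isClosed_submodule (G j)
  · intro j
    induction j using Fin.lastCases with
    | last => simpa [f] using hT
    | cast j => simpa [f] using isIrreducible_submodule (G j)
  · intro j
    induction j using Fin.lastCases with
    | last => simpa [f] using hTZ
    | cast j =>
      simp only [f, Fin.snoc_castSucc]
      exact Set.Subset.trans (hGL j) (hLT.subset.trans hTZ)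

end Zariski

/-! ### The filtration, centralizers and the `[p]`-map in the Witt algebra. -/

section Witt

open Polynomial

variable {k : Type*} [Field k] {p : ℕ}

theorem x_pow_p : x k p ^ p = 0 := by
  rw [x, ← map_pow, AdjoinRoot.mk_self]

theorem smul_x_pow_eq_zero [Fact p.Prime] {c : k} (h : c • x k p ^ (p - 1) = 0) : c = 0 := by
  have hp : 0 < p := (Fact.out : p.Prime).pos
  have h' : AdjoinRoot.mk (X ^ p : k[X]) (C c * X ^ (p - 1)) = 0 := by
    rw [← h, map_mul, map_pow, Algebra.smul_def]
    rfl
  rw [AdjoinRoot.mk_eq_zero, X_pow_dvd_iff] at h'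
  simpa using h' (p - 1) (by omega)

theorem eq_zero_of_x_pow_dvd [Fact p.Prime] {c : k} {m : ℕ} (hm : m < p)
    (h : x k p ^ (m + 1) ∣ c • x k p ^ m) : c = 0 := by
  apply smul_x_pow_eq_zero (p := p)
  obtain ⟨t, ht⟩ := h
  have h1 : p - 1 = m + (p - 1 - m) := by omega
  have h2 : (m + 1) + (p - 1 - m) = p := by omega
  calc c • x k p ^ (p - 1) = (c • x k p ^ m) * x k p ^ (p - 1 - m) := by
        rw [h1, pow_add, smul_mul_assoc, ← h1]
    _ = x k p ^ (m + 1 + (p - 1 - m)) * t := by rw [ht]; ring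
    _ = 0 := by rw [h2, x_pow_p, zero_mul]

theorem exists_eq_algebraMap_add (t : Trunc k p) :
    ∃ (a : k) (s : Trunc k p), t = algebraMap k _ a + x k p * s := by
  obtain ⟨f, rfl⟩ := AdjoinRoot.mk_surjective t
  refine ⟨f.coeff 0, AdjoinRoot.mk _ f.divX, ?_⟩
  conv_lhs => rw [← f.X_mul_divX_add, map_add, map_mul, add_comm]
  rfl

theorem derivation_ext {d e : W k p} (h : d (x k p) = e (x k p)) : d = e :=
  Derivation.ext_of_adjoin_eq_top {x k p} AdjoinRoot.adjoinRoot_eq_top (by simpa using h)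

instance : Module.Finite k (Trunc k p) := (monic_X_pow p).finite_adjoinRoot

/-- Evaluation of derivations at the coset of `X`. -/
noncomputable def evalX (k : Type*) [Field k] (p : ℕ) : W k p →ₗ[k] Trunc k p where
  toFun d := d (x k p)
  map_add' _ _ := rfl
  map_smul' _ _ := rfl

instance : FiniteDimensional k (W k p) :=
  FiniteDimensional.of_injective (evalX k p) fun _ _ h => derivation_ext h

variable [CharP k p]

theorem D_x : D k p (x k p) = 1 := by simpa using D_x_pow k p 1

theorem eq_smul_D (d : W k p) : d = d (x k p) • D k p :=
  derivation_ext (by simp [D_x])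

theorem apply_eq_mul_D (d : W k p) (t : Trunc k p) : d t = d (x k p) * D k p t := by
  conv_lhs => rw [eq_smul_D d]
  rfl

theorem lie_apply_x (d e : W k p) :
    ⁅d, e⁆ (x k p) = d (x k p) * D k p (e (x k p)) - e (x k p) * D k p (d (x k p)) := by
  rw [Derivation.commutator_apply, apply_eq_mul_D d (e _), apply_eq_mul_D e (d _)]

theorem lie_eq_zero_iff {d e : W k p} :
    ⁅d, e⁆ = 0 ↔ d (x k p) * D k p (e (x k p)) - e (x k p) * D k p (d (x k p)) = 0 := by
  rw [← lie_apply_x]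
  exact ⟨fun h => by simp [h], fun h => derivation_ext (by simpa using h)⟩

theorem x_pow_dvd_D {n : ℕ} {t : Trunc k p} (h : x k p ^ (n + 1) ∣ t) : x k p ^ n ∣ D k p t := by
  obtain ⟨s, rfl⟩ := h
  rw [Derivation.leibniz, D_x_pow, smul_eq_mul, smul_eq_mul]
  refine dvd_add ?_ ?_
  · exact (pow_dvd_pow _ n.le_succ).mul_right _
  · exact ((dvd_refl _).mul_left _).mul_left _

theorem x_pow_smul_D_mem_filtration {i m : ℕ} (h : i + 1 ≤ m) :
    x k p ^ m • D k p ∈ filtration k p i := by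
  by_cases hm : m < p
  · exact Submodule.subset_span ⟨(m : ℤ) - 1, by omega, by omega, by omega, by simp⟩
  · simp [pow_eq_zero_of_le (not_lt.mp hm) x_pow_p]

/-- The filtration in terms of divisibility of the coefficient of `D`. -/
theorem mem_filtration_iff {i : ℕ} {d : W k p} :
    d ∈ filtration k p i ↔ x k p ^ (i + 1) ∣ d (x k p) := by
  constructor
  · intro h
    unfold filtration at h
    induction h using Submodule.span_induction with
    | zero => simp
    | add u v _ _ hu hv => exact dvd_add hu hv
    | smul c u _ hu =>
      rw [Derivation.smul_apply, Algebra.smul_def]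
      exact hu.mul_left _
    | mem u hu =>
      obtain ⟨j, hij, -, -, rfl⟩ := hu
      rw [Derivation.smul_apply, D_x, smul_eq_mul, mul_one]
      exact pow_dvd_pow _ (by omega)
  · rintro ⟨t, ht⟩
    rw [eq_smul_D d, ht]
    clear ht
    obtain ⟨f, rfl⟩ := AdjoinRoot.mk_surjective t
    induction f using Polynomial.induction_on' with
    | add f g hf hg =>
      rw [map_add, mul_add, add_smul]
      exact add_mem hf hg
    | monomial n c =>
      have : x k p ^ (i + 1) * AdjoinRoot.mk (X ^ p) (monomial n c) =
          c • x k p ^ (i + 1 + n) := by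
        rw [← C_mul_X_pow_eq_monomial, map_mul, map_pow, Algebra.smul_def, pow_add]
        change _ * (algebraMap k (Trunc k p) c * x k p ^ n) = _
        ring
      rw [this, smul_assoc]
      exact Submodule.smul_mem _ _ (x_pow_smul_D_mem_filtration (by omega))

theorem filtration_anti {i j : ℕ} (h : i ≤ j) : filtration k p j ≤ filtration k p i := fun _ hd =>
  mem_filtration_iff.mpr ((pow_dvd_pow _ (by omega)).trans (mem_filtration_iff.mp hd))

/-- An element of `𝔤_i` is the sum of a multiple of `X ^ (i + 1) D` and an element of
`𝔤_{i+1}`. -/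
theorem exists_eq_smul_add {i : ℕ} {d : W k p} (hd : d ∈ filtration k p i) :
    ∃ (a : k), ∃ e ∈ filtration k p (i + 1 : ℕ), d = a • (x k p ^ (i + 1) • D k p) + e := by
  obtain ⟨t, ht⟩ := mem_filtration_iff.mp hd
  obtain ⟨a, s, rfl⟩ := exists_eq_algebraMap_add t
  refine ⟨a, (x k p ^ (i + 1 + 1) * s) • D k p, mem_filtration_iff.mpr ?_, derivation_ext ?_⟩
  · simp [D_x]
  · simp [D_x, ht, Algebra.smul_def]
    ring

/-- The leading term of the bracket. -/
theorem leading_coeff_mul_eq_zero [Fact p.Prime] {m n : ℕ} (hm : 1 ≤ m) (hmn : m + n ≤ p)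
    {a b : k} {u v : Trunc k p} {d e : W k p} (hde : ⁅d, e⁆ = 0)
    (hd : d (x k p) = x k p ^ m * (algebraMap k _ a + x k p * u))
    (he : e (x k p) = x k p ^ n * (algebraMap k _ b + x k p * v)) :
    ((n : k) - m) * a * b = 0 := by
  rw [lie_eq_zero_iff, hd, he] at hde
  have hm' : x k p ^ m = x k p ^ (m - 1) * x k p := by
    rw [← pow_succ]
    congr 1
    omega
  -- For `n = 0` the truncated exponent is harmless, because the factor `n` vanishes.
  have hn' : (n : Trunc k p) * x k p ^ (n - 1) * x k p = n * x k p ^ n := by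
    rcases n with - | n
    · simp
    · rw [Nat.add_sub_cancel, mul_assoc, ← pow_succ]
  have hDa : ∀ c : k, D k p (algebraMap k _ c) = 0 := fun c => (D k p).map_algebraMap c
  simp only [Derivation.leibniz, map_add, hDa, D_x, D_x_pow, smul_eq_mul] at hde
  apply smul_x_pow_eq_zero (p := p)
  -- Multiplying by `X ^ (p - m - n)` moves the leading term of the bracket to the top nonzero power
  -- `X ^ (p - 1)` and kills everything beyond it.
  have hpow : x k p ^ (p - 1) = x k p ^ (m - 1) * x k p ^ n * x k p ^ (p - m - n) := by
    rw [← pow_add, ← pow_add]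
    congr 1
    omega
  have hpow' : x k p * (x k p ^ (m - 1) * x k p ^ n * x k p ^ (p - m - n)) = 0 := by
    rw [← hpow, ← pow_succ', Nat.sub_add_cancel (Fact.out : p.Prime).pos, x_pow_p]
  rw [hpow, Algebra.smul_def]
  simp only [map_mul, map_sub, map_natCast]
  set X := x k p
  set Y := X ^ (m - 1)
  set Z := X ^ n
  set N := X ^ (n - 1)
  set R := X ^ (p - m - n)
  set α := algebraMap k (Trunc k p) a
  set β := algebraMap k (Trunc k p) b
  set u' := X * D k p u + u
  set v' := X * D k p v + v
  rw [hm'] at hde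
  linear_combination R * hde - Y * (α + X * u) * (β + X * v) * R * hn' -
    (((n : Trunc k p) - m) * (α * v + β * u + X * u * v) + (α + X * u) * v' -
      (β + X * v) * u') * hpow'

/-- The centralizer of an element `d` of `𝔤_i ∖ 𝔤_{i+1}` is contained in `k d + 𝔤_{p-1-i}`. -/
theorem exists_sub_smul_mem_of_lie_eq_zero [Fact p.Prime] {i : ℕ} (hi : i + 2 ≤ p) {d e : W k p}
    (hd : d ∈ filtration k p i) (hd' : d ∉ filtration k p (i + 1 : ℕ)) (hde : ⁅d, e⁆ = 0) :
    ∃ c : k, e - c • d ∈ filtration k p (p - 1 - i : ℕ) := by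
  -- The coefficients of `e - c • d` are cleared one power of `X` at a time. At `n = i + 1`, where
  -- `d` itself begins, `c` is adjusted; at any other `n`, commutation with `d` forces the
  -- coefficient to vanish.
  suffices h : ∀ n, n ≤ p - i → ∃ c : k, x k p ^ n ∣ (e - c • d) (x k p) by
    obtain ⟨c, hc⟩ := h (p - i) le_rfl
    refine ⟨c, mem_filtration_iff.mpr ?_⟩
    rwa [show p - 1 - i + 1 = p - i by omega]
  obtain ⟨t, ht⟩ := mem_filtration_iff.mp hd
  obtain ⟨a, u, rfl⟩ := exists_eq_algebraMap_add t
  have ha : a ≠ 0 := by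
    rintro rfl
    refine hd' (mem_filtration_iff.mpr ⟨u, ?_⟩)
    rw [ht, map_zero, pow_succ _ (i + 1)]
    ring
  intro n
  induction n with
  | zero => exact fun _ => ⟨0, by simp⟩
  | succ n ih =>
    intro hn
    obtain ⟨c, s, hs⟩ := ih (by omega)
    obtain ⟨b, v, rfl⟩ := exists_eq_algebraMap_add s
    by_cases hni : n = i + 1
    · subst hni
      refine ⟨c + b / a, v - (b / a) • u, ?_⟩
      have h1 : (e - (c + b / a) • d) (x k p) = (e - c • d) (x k p) - (b / a) • d (x k p) := by
        rw [add_smul, Derivation.sub_apply, Derivation.sub_apply, Derivation.add_apply,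
          Derivation.smul_apply, Derivation.smul_apply]
        ring
      have h2 : algebraMap k (Trunc k p) (b / a) * algebraMap k _ a = algebraMap k _ b := by
        rw [← map_mul, div_mul_cancel₀ _ ha]
      rw [h1, hs, ht, Algebra.smul_def, Algebra.smul_def, ← h2]
      ring
    · refine ⟨c, v, ?_⟩
      have h0 : ⁅d, e - c • d⁆ = 0 := by simp [hde]
      have h := leading_coeff_mul_eq_zero (by omega) (by omega) h0 ht hs
      have hne : (n : k) - (i + 1 : ℕ) ≠ 0 := by
        rw [sub_ne_zero]
        intro h
        refine hni ((CharP.natCast_injOn_Iio k p) ?_ ?_ h)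
        · simp only [Set.mem_Iio]; omega
        · simp only [Set.mem_Iio]; omega
      have hb : b = 0 := (mul_eq_zero.mp h).resolve_left (mul_ne_zero hne ha)
      rw [hs, hb, map_zero, pow_succ]
      ring

/-- Both products in the bracket are divisible by `X ^ (i + j + 1)`, since `D` lowers the order by
at most one. -/
theorem lie_eq_zero_of_mem {i j : ℕ} (hij : p ≤ i + j + 1) {d e : W k p}
    (hd : d ∈ filtration k p i) (he : e ∈ filtration k p j) : ⁅d, e⁆ = 0 := by
  have key : ∀ {i j : ℕ}, p ≤ i + j + 1 → ∀ {d e : W k p}, d ∈ filtration k p i →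
      e ∈ filtration k p j → d (x k p) * D k p (e (x k p)) = 0 := by
    intro i j hij d e hd he
    have := mul_dvd_mul (mem_filtration_iff.mp hd) (x_pow_dvd_D (mem_filtration_iff.mp he))
    rwa [← pow_add, pow_eq_zero_of_le (by omega) x_pow_p, zero_dvd_iff] at this
  rw [lie_eq_zero_iff, key hij hd he, key (by omega) he hd, sub_zero]

variable [Fact p.Prime]

theorem pMap_eq_zero_iff {d : W k p} :
    pMap d = 0 ↔ ((d : Module.End k (Trunc k p)) ^ p) (x k p) = 0 :=
  ⟨fun h => congrArg (fun d : W k p => d (x k p)) h, fun h => derivation_ext h⟩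

/-- An element of `𝔤₁` raises the order of vanishing, so its `p`-th power sends `X` into `(X ^ p) =
0`. -/
theorem pMap_eq_zero_of_mem {d : W k p} (hd : d ∈ filtration k p 1) : pMap d = 0 := by
  have h2 : x k p ^ 2 ∣ d (x k p) := mem_filtration_iff (i := 1).mp (by simpa using hd)
  have h : ∀ n, x k p ^ n ∣ ((d : Module.End k (Trunc k p)) ^ n) (x k p) := by
    intro n
    induction n with
    | zero => simp
    | succ n ih =>
      rw [pow_succ' (d : Module.End k (Trunc k p)), Module.End.mul_apply]
      change _ ∣ d _
      rw [apply_eq_mul_D]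
      rcases n with - | n
      · exact ((pow_dvd_pow _ (by omega)).trans h2).mul_right _
      · have := mul_dvd_mul h2 (x_pow_dvd_D ih)
        rw [← pow_add] at this
        exact (pow_dvd_pow _ (by omega)).trans this
  rw [pMap_eq_zero_iff]
  simpa [x_pow_p] using h p

/-- The nilpotent variety of the standard Borel subalgebra. -/
theorem nilpotentVariety_borel : nilpotentVariety (borel k p) = (filtration k p 1 : Set (W k p)) := by
  have hp := (Fact.out : p.Prime).two_le
  ext d
  constructor
  · rintro ⟨hd, hd0⟩
    have hd : d ∈ filtration k p (0 : ℕ) := hd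
    obtain ⟨t, ht⟩ := mem_filtration_iff.mp hd
    obtain ⟨a, u, rfl⟩ := exists_eq_algebraMap_add t
    rw [zero_add, pow_one] at ht
    -- On the line `(X) / (X ^ 2)` the derivation `d` acts as the scalar `a`, so nilpotency forces
    -- `a ^ p = 0`.
    have h : ∀ n, x k p ^ 2 ∣ ((d : Module.End k (Trunc k p)) ^ n) (x k p) - a ^ n • x k p := by
      intro n
      induction n with
      | zero => simp
      | succ n ih =>
        rw [pow_succ' (d : Module.End k (Trunc k p)), Module.End.mul_apply]
        change _ ∣ d _ - _
        obtain ⟨z, hz⟩ : ∃ z, ((d : Module.End k (Trunc k p)) ^ n) (x k p) = z := ⟨_, rfl⟩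
        rw [hz] at ih ⊢
        have h1 : d z - a ^ (n + 1) • x k p =
            d (z - a ^ n • x k p) + a ^ n • (d (x k p) - a • x k p) := by
          rw [map_sub, Derivation.map_smul, smul_sub, smul_smul, pow_succ]
          abel
        rw [h1]
        refine dvd_add ?_ ?_
        · rw [apply_eq_mul_D, pow_two]
          refine mul_dvd_mul (ht ▸ dvd_mul_right _ _) ?_
          simpa using x_pow_dvd_D (n := 1) ih
        · rw [ht, Algebra.smul_def, Algebra.smul_def]
          exact Dvd.intro (algebraMap k _ (a ^ n) * u) (by ring)
    have hap : a ^ p = 0 := by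
      have := h p
      rw [pMap_eq_zero_iff.mp hd0, zero_sub, dvd_neg] at this
      exact eq_zero_of_x_pow_dvd (p := p) (m := 1) (by omega) (by simpa using this)
    have ha : a = 0 := pow_eq_zero_iff (by omega) |>.mp hap
    refine mem_filtration_iff (i := 1).mpr ⟨u, ?_⟩
    rw [ht, ha, map_zero]
    ring
  · intro hd
    exact ⟨filtration_anti (i := 0) (j := 1) (Nat.zero_le 1) hd, pMap_eq_zero_of_mem hd⟩

theorem x_pow_smul_D_notMem {i : ℕ} (hi : i + 2 ≤ p) :
    x k p ^ (i + 1) • D k p ∉ filtration k p (i + 1 : ℕ) := by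
  intro h
  rw [mem_filtration_iff] at h
  refine one_ne_zero (eq_zero_of_x_pow_dvd (k := k) (p := p) (m := i + 1) (by omega) ?_)
  simpa [D_x] using h

/-- The generators give the upper bound; the strict inclusions `𝔤_{j+1} ⊂ 𝔤_j` give the lower one.
-/
theorem finrank_filtration {i : ℕ} (hi : i + 1 ≤ p) :
    Module.finrank k (filtration k p i) = p - 1 - i := by
  refine le_antisymm ?_ ?_
  · have hle : filtration k p i ≤
        Submodule.span k (Set.range fun j : Fin (p - 1 - i) => x k p ^ (i + 1 + j) • D k p) := by
      refine Submodule.span_mono ?_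
      rintro _ ⟨j, hij, -, hj, rfl⟩
      exact ⟨⟨j.toNat - i, by omega⟩, by
        simp only
        congr 2
        omega⟩
    refine (Submodule.finrank_mono hle).trans ((finrank_range_le_card _).trans ?_)
    simp
  · have h : ∀ n i, n + i + 1 = p → n ≤ Module.finrank k (filtration k p (i : ℕ)) := by
      intro n
      induction n with
      | zero => simp
      | succ n ih =>
        intro i hi
        refine Nat.succ_le_of_lt ((ih (i + 1) (by omega)).trans_lt ?_)
        refine Submodule.finrank_lt_finrank_of_lt (lt_of_le_of_ne (filtration_anti (by omega)) ?_)
        intro h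
        refine x_pow_smul_D_notMem (k := k) (p := p) (i := i) (by omega) ?_
        rw [h]
        exact x_pow_smul_D_mem_filtration le_rfl
    exact h _ _ (by omega)

end Witt

/-! ### The closures `ℭ(i)` and the decomposition of the commuting variety. -/

section Components

variable (k : Type*) [Field k] (p : ℕ) [CharP k p]

/-- The pairs `(d, c d + e)` with `d ∈ 𝔤_i`, `c ∈ k` and `e ∈ 𝔤_{p-1-i}`. -/
def paramSet (i : ℕ) : Set (W k p × W k p) :=
  {q | q.1 ∈ filtration k p i ∧ ∃ c : k, q.2 - c • q.1 ∈ filtration k p (p - 1 - i : ℕ)}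

/-- The parametrization of `paramSet`. -/
noncomputable def paramMap (i : ℕ) (t : filtration k p i × k × filtration k p (p - 1 - i : ℕ)) :
    W k p × W k p :=
  (t.1, t.2.1 • (t.1 : W k p) + t.2.2)

variable {k p}

theorem range_paramMap (i : ℕ) : range (paramMap k p i) = paramSet k p i := by
  ext q
  constructor
  · rintro ⟨⟨d, c, e⟩, rfl⟩
    exact ⟨d.2, c, by simp [paramMap]⟩
  · rintro ⟨hd, c, he⟩
    exact ⟨(⟨q.1, hd⟩, c, ⟨_, he⟩), by simp [paramMap]⟩

theorem isPolyMap_paramMap (i : ℕ) : IsPolyMap k (paramMap k p i) := by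
  have h1 : IsPolyMap k fun t : filtration k p i × k × filtration k p (p - 1 - i : ℕ) =>
      (t.1 : W k p) :=
    isPolyMap_linear ((filtration k p i).subtype ∘ₗ
      LinearMap.fst k _ (k × filtration k p (p - 1 - i : ℕ)))
  have h2 : IsPolyMap k fun t : filtration k p i × k × filtration k p (p - 1 - i : ℕ) => t.2.1 :=
    isPolyMap_linear (LinearMap.fst k k (filtration k p (p - 1 - i : ℕ)) ∘ₗ
      LinearMap.snd k (filtration k p i) _)
  have h3 : IsPolyMap k fun t : filtration k p i × k × filtration k p (p - 1 - i : ℕ) =>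
      (t.2.2 : W k p) :=
    isPolyMap_linear
      ((filtration k p (p - 1 - i : ℕ)).subtype ∘ₗ LinearMap.snd k k _ ∘ₗ
        LinearMap.snd k (filtration k p i) _)
  exact h1.prodMk ((h2.bilinear (LinearMap.lsmul k (W k p)) h1).add h3)

variable [Fact p.Prime]

variable (k p) in
/-- The nilpotent commuting variety of the standard Borel subalgebra. -/
abbrev borelCommuting : Set (W k p × W k p) := commutingVariety (nilpotentVariety (borel k p))

theorem mem_borelCommuting {q : W k p × W k p} :
    q ∈ borelCommuting k p ↔
      q.1 ∈ filtration k p (1 : ℕ) ∧ q.2 ∈ filtration k p (1 : ℕ) ∧ ⁅q.1, q.2⁆ = 0 := by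
  rw [borelCommuting, nilpotentVariety_borel]
  rfl

theorem paramSet_subset_borelCommuting {i : ℕ} (hi : 1 ≤ i) (hi' : i + 2 ≤ p) :
    paramSet k p i ⊆ borelCommuting k p := by
  rintro ⟨d, e⟩ ⟨hd, c, he⟩
  have hd1 := filtration_anti hi hd
  refine mem_borelCommuting.mpr ⟨hd1, ?_, ?_⟩
  · have := add_mem (filtration_anti (j := p - 1 - i) (i := 1) (by omega) he)
      (Submodule.smul_mem _ c hd1)
    simpa using this
  · have := lie_eq_zero_of_mem (by omega) hd he
    have hsmul : ⁅d, c • d⁆ = 0 := (lie_smul c d d).trans (by rw [lie_self, smul_zero])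
    exact (sub_eq_zero.mp ((lie_sub d e (c • d)).symm.trans this)).trans hsmul

/-- By the description of centralizers, everything commuting with the first entry already lies in
`𝔤₁`, so nilpotency is automatic. -/
theorem mem_stratum_iff {i : ℕ} (hi : 1 ≤ i) (hi' : i + 2 ≤ p) {q : W k p × W k p} :
    q ∈ stratum k p i ↔ q ∈ paramSet k p i ∧ q.1 ∉ filtration k p (i + 1 : ℕ) := by
  have hcast : ((i + 1 : ℕ) : ℤ) = (i : ℤ) + 1 := by push_cast; rfl
  constructor
  · rintro ⟨⟨-, -, hq⟩, hq1, hq2⟩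
    rw [← hcast] at hq2
    exact ⟨⟨hq1, exists_sub_smul_mem_of_lie_eq_zero hi' hq1 hq2 hq⟩, hq2⟩
  · rintro ⟨hq, hq2⟩
    obtain ⟨h1, h2, h3⟩ := mem_borelCommuting.mp (paramSet_subset_borelCommuting hi hi' hq)
    exact ⟨⟨⟨trivial, pMap_eq_zero_of_mem h1⟩, ⟨trivial, pMap_eq_zero_of_mem h2⟩, h3⟩, hq.1,
      hcast ▸ hq2⟩

theorem isClosed_frakC (i : ℕ) : IsClosed[zariski k (W k p × W k p)] (frakC k p i) :=
  @isClosed_closure _ (zariski k (W k p × W k p)) _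

theorem isClosed_borelCommuting : IsClosed[zariski k _] (borelCommuting k p) := by
  have h1 := isPolyMap_linear (LinearMap.fst k (W k p) (W k p))
  have h2 := isPolyMap_linear (LinearMap.snd k (W k p) (W k p))
  have h3 := h1.bilinear (LinearMap.mk₂ k (fun d e : W k p => ⁅d, e⁆) add_lie smul_lie
    lie_add fun c d e => lie_smul c d e) h2
  let _ := zariski k (W k p × W k p)
  let _ := zariski k (W k p)
  have h : borelCommuting k p = (Prod.fst ⁻¹' (filtration k p (1 : ℕ) : Set (W k p))) ∩
      ((Prod.snd ⁻¹' (filtration k p (1 : ℕ) : Set (W k p))) ∩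
        ((fun q : W k p × W k p => ⁅q.1, q.2⁆) ⁻¹' ((⊥ : Submodule k (W k p)) : Set (W k p)))) := by
    ext q
    rw [mem_borelCommuting]
    rfl
  rw [h]
  exact ((isClosed_submodule _).preimage h1.continuous).inter
    (((isClosed_submodule _).preimage h2.continuous).inter
      ((isClosed_submodule _).preimage h3.continuous))

variable [IsAlgClosed k]

/-- `ℭ(i)` is the closure of the image of its parametrization. -/
theorem frakC_eq {i : ℕ} (hi : 1 ≤ i) (hi' : i + 2 ≤ p) :
    frakC k p i = zariskiClosure k (paramSet k p i) := by
  have : Infinite k := IsAlgClosed.instInfinite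
  let _ := zariski k (W k p × W k p)
  refine (closure_mono fun q hq => ((mem_stratum_iff hi hi').mp hq).1).antisymm
    (closure_minimal ?_ (isClosed_frakC i))
  rintro ⟨d, e⟩ hq
  by_cases hd : d ∈ filtration k p (i + 1 : ℕ)
  · obtain ⟨hd1, c, he⟩ := hq
    have hx := x_pow_smul_D_mem_filtration (k := k) (p := p) (le_refl (i + 1))
    have hx' := x_pow_smul_D_notMem (k := k) hi'
    -- Moving `d` by `t X ^ (i + 1) D` and `e` by `c` times as much leaves `e - c • d` fixed and,
    -- for `t ≠ 0`, takes `d` out of `𝔤_{i+1}`.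
    refine mem_of_forall_ne_zero (isClosed_frakC i)
      (u := (x k p ^ (i + 1) • D k p, c • (x k p ^ (i + 1) • D k p))) fun t ht => ?_
    refine subset_closure ((mem_stratum_iff hi hi').mpr ⟨⟨?_, c, ?_⟩, fun h => hx' ?_⟩)
    · exact add_mem hd1 (Submodule.smul_mem _ t hx)
    · convert! he using 1
      simp only [Prod.mk_add_mk, Prod.smul_mk]
      module
    · rw [← Submodule.smul_mem_iff _ ht]
      simpa using! sub_mem h hd
  · exact subset_closure ((mem_stratum_iff hi hi').mpr ⟨hq, hd⟩)

theorem paramSet_subset_frakC {i : ℕ} (hi : 1 ≤ i) (hi' : i + 2 ≤ p) :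
    paramSet k p i ⊆ frakC k p i := by
  rw [frakC_eq hi hi']
  exact @subset_closure _ (zariski k _) _

theorem isIrreducible_frakC {i : ℕ} (hi : 1 ≤ i) (hi' : i + 2 ≤ p) :
    @IsIrreducible _ (zariski k (W k p × W k p)) (frakC k p i) := by
  have : Infinite k := IsAlgClosed.instInfinite
  let _ := zariski k (W k p × W k p)
  rw [frakC_eq hi hi', ← range_paramMap]
  exact isIrreducible_iff_closure.mpr (isPolyMap_paramMap i).isIrreducible_range

theorem trdeg_coordRing_frakC_le {i : ℕ} (hi : 1 ≤ i) (hi' : i + 2 ≤ p) :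
    Algebra.trdeg k (coordRing k (frakC k p i)) ≤ p := by
  have : Infinite k := IsAlgClosed.instInfinite
  have h := trdeg_coordRing_closure_le (isPolyMap_paramMap (k := k) (p := p) i)
    (T := frakC k p i) (by rw [range_paramMap, frakC_eq hi hi'])
    (by rw [range_paramMap]; exact paramSet_subset_frakC hi hi')
  rwa [Module.finrank_prod, Module.finrank_prod, finrank_filtration (by omega),
    finrank_filtration (by omega), Module.finrank_self,
    show p - 1 - i + (1 + (p - 1 - (p - 1 - i))) = p by omega] at h

theorem frakC_subset_borelCommuting {i : ℕ} (hi : 1 ≤ i) (hi' : i + 2 ≤ p) :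
    frakC k p i ⊆ borelCommuting k p := by
  rw [frakC_eq hi hi']
  let _ := zariski k (W k p × W k p)
  exact closure_minimal (paramSet_subset_borelCommuting hi hi')
    isClosed_borelCommuting

/-- If `i < j`, first entries in `ℭ(j)` lie in `𝔤_{i+1}`, unlike those in `ℭ(i)`. If `j < i`, the
entries of a pair in `paramSet k p j` are proportional modulo `𝔤_{p-i}`, so a minor vanishes on
`ℭ(j)`; it does not vanish at `(X ^ (i + 1) D, X ^ (p - i) D)`. -/
theorem eq_of_frakC_subset {i j : ℕ} (hi : 1 ≤ i) (hi' : 2 * i + 3 ≤ p) (hj : 1 ≤ j)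
    (hj' : 2 * j + 3 ≤ p) (h : frakC k p i ⊆ frakC k p j) : i = j := by
  have hi2 : i + 2 ≤ p := by omega
  have hj2 : j + 2 ≤ p := by omega
  have hle : j ≤ i := by
    by_contra! hlt
    have hcl : frakC k p j ⊆ {q | q.1 ∈ filtration k p (i + 1 : ℕ)} := by
      rw [frakC_eq hj hj2]
      let _ := zariski k (W k p × W k p)
      let _ := zariski k (W k p)
      exact closure_minimal (fun q hq => filtration_anti hlt hq.1) ((isClosed_submodule _).preimage
        (isPolyMap_linear (LinearMap.fst k (W k p) (W k p))).continuous)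
    refine x_pow_smul_D_notMem (k := k) hi2 (hcl (h (paramSet_subset_frakC hi hi2
      (a := (x k p ^ (i + 1) • D k p, 0)) ⟨x_pow_smul_D_mem_filtration le_rfl, 0, by simp⟩)))
  refine hle.antisymm' ?_
  by_contra! hlt
  obtain ⟨l, hl⟩ : ∃ l, l = p - 1 - i := ⟨_, rfl⟩
  -- `f` and `g` detect the leading coefficients in `𝔤_i` and `𝔤_l`: they vanish on `𝔤_{i+1}` and
  -- `𝔤_{l+1}` respectively.
  obtain ⟨f, hf, hf'⟩ := Submodule.exists_le_ker_of_notMem (x_pow_smul_D_notMem (k := k) hi2)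
  obtain ⟨g, hg, hg'⟩ := Submodule.exists_le_ker_of_notMem
    (x_pow_smul_D_notMem (k := k) (p := p) (i := l) (by omega))
  have hpoly : (fun q : W k p × W k p => f q.1 * g q.2 - g q.1 * f q.2) ∈
      polyFun k (W k p × W k p) :=
    sub_mem (mul_mem (linear_mem_polyFun (f ∘ₗ LinearMap.fst k _ (W k p)))
      (linear_mem_polyFun (g ∘ₗ LinearMap.snd k (W k p) _)))
      (mul_mem (linear_mem_polyFun (g ∘ₗ LinearMap.fst k _ (W k p)))
      (linear_mem_polyFun (f ∘ₗ LinearMap.snd k (W k p) _)))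
  have hcl : frakC k p j ⊆ {q | f q.1 * g q.2 - g q.1 * f q.2 = 0} := by
    rw [frakC_eq hj hj2]
    let _ := zariski k (W k p × W k p)
    refine closure_minimal ?_ (isClosed_zeros hpoly)
    rintro ⟨d, e⟩ ⟨-, c, hc⟩
    have hfe : f (e - c • d) = 0 := hf' (filtration_anti (by omega) hc)
    have hge : g (e - c • d) = 0 := hg' (filtration_anti (by omega) hc)
    rw [map_sub, map_smul, sub_eq_zero] at hfe hge
    simp only [mem_ofPred_eq, hfe, hge, smul_eq_mul]
    ring
  have hmem : ((x k p ^ (i + 1) • D k p, x k p ^ (l + 1) • D k p) : W k p × W k p) ∈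
      frakC k p i := paramSet_subset_frakC hi hi2
    ⟨x_pow_smul_D_mem_filtration le_rfl, 0, by
      simpa [← hl] using x_pow_smul_D_mem_filtration le_rfl⟩
  have h0 : f (x k p ^ (l + 1) • D k p) = 0 := hf' (x_pow_smul_D_mem_filtration (by omega))
  have h1 : f _ * g _ - g _ * f _ = 0 := hcl (h hmem)
  rw [h0, mul_zero, sub_zero] at h1
  exact mul_ne_zero hf hg h1

/-- A closed set that contains `ℭ(i)` for `i` below the middle contains all pairs in
`𝔤_i × 𝔤_{p-1-i}` for `i` above the middle. -/
theorem mk_mem_of_paramSet_subset {F : Set (W k p × W k p)} (hF : IsClosed[zariski k _] F)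
    (hp : 3 < p) (hPF : ∀ i, 1 ≤ i → 2 * i + 3 ≤ p → paramSet k p i ⊆ F) {i : ℕ} (hi : i + 2 ≤ p)
    (hi' : p < 2 * i + 3) {d e : W k p} (hd : d ∈ filtration k p i)
    (he : e ∈ filtration k p (p - 1 - i : ℕ)) : (d, e) ∈ F := by
  have : Infinite k := IsAlgClosed.instInfinite
  have hodd : p % 2 = 1 := (Fact.out : p.Prime).eq_two_or_odd.resolve_left (by omega)
  by_cases hmid : p = 2 * i + 1
  -- In the middle case `i = (p - 1) / 2` both entries lie in `𝔤_i`, and the stratum to approach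
  -- from is `j = i - 1`.
  · obtain ⟨j, rfl⟩ : ∃ j, i = j + 1 := ⟨i - 1, by omega⟩
    have hsub : p - 1 - (j + 1) = j + 1 := by omega
    have hsub' : p - 1 - j = j + 1 + 1 := by omega
    rw [hsub] at he
    set v := x k p ^ (j + 1 + 1) • D k p with hv
    set w := x k p ^ (j + 1) • D k p with hw
    have hvm : v ∈ filtration k p (j + 1 : ℕ) := x_pow_smul_D_mem_filtration le_rfl
    have hwm : w ∈ filtration k p j := x_pow_smul_D_mem_filtration le_rfl
    obtain ⟨b, e', he', rfl⟩ := exists_eq_smul_add he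
    have main : ∀ a : k, a ≠ 0 → ∀ d' ∈ filtration k p (j + 1 + 1 : ℕ),
        (a • v + d', b • v + e') ∈ F := by
      intro a ha d' hd'
      -- The direction is proportional to the leading parts `(a • v, b • v)`, so subtracting `b / a`
      -- times the first entry cancels both and leaves an element of `𝔤_{j+2} = 𝔤_{p-1-j}`.
      refine mem_of_forall_ne_zero hF (u := (a • w, b • w)) fun t ht => ?_
      refine hPF j (by omega) (by omega) ⟨?_, b / a, ?_⟩
      · exact add_mem (add_mem (Submodule.smul_mem _ _ (filtration_anti j.le_succ hvm))
          (filtration_anti (by omega) hd')) (Submodule.smul_mem _ _ (Submodule.smul_mem _ _ hwm))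
      · rw [hsub']
        have : b • v + e' + t • b • w - (b / a) • (a • v + d' + t • a • w) =
            e' - (b / a) • d' := by
          have hb : b = b / a * a := (div_mul_cancel₀ b ha).symm
          set c := b / a
          rw [hb]
          module
        change b • v + e' + t • b • w - (b / a) • (a • v + d' + t • a • w) ∈ _
        rw [this]
        exact sub_mem he' (Submodule.smul_mem _ _ hd')
    obtain ⟨a, d', hd', rfl⟩ := exists_eq_smul_add hd
    by_cases ha : a = 0
    · refine mem_of_forall_ne_zero hF (u := (v, 0)) fun t ht => ?_
      have := main t ht d' hd'
      convert! this using 1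
      simp [ha, add_comm, hv]
    · exact main a ha d' hd'
  -- Beyond the middle the roles swap: `(d + t • e, e)` belongs to the index `p - 1 - i`, with
  -- scalar `t⁻¹` and remainder `-t⁻¹ • d ∈ 𝔤_i`.
  · refine mem_of_forall_ne_zero hF (u := (e, 0)) fun t ht => ?_
    have hj : p - 1 - (p - 1 - i) = i := by omega
    refine hPF (p - 1 - i) (by omega) (by omega) ⟨?_, t⁻¹, ?_⟩
    · exact add_mem (filtration_anti (by omega) hd) (Submodule.smul_mem _ _ he)
    · rw [hj]
      have : e - t⁻¹ • (d + t • e) = -(t⁻¹ • d) := by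
        rw [smul_add, smul_smul, inv_mul_cancel₀ ht]
        module
      convert! neg_mem (Submodule.smul_mem _ t⁻¹ hd) using 1
      simpa using this

theorem borelCommuting_subset {F : Set (W k p × W k p)} (hF : IsClosed[zariski k _] F)
    (hp : 3 < p) (hPF : ∀ i, 1 ≤ i → 2 * i + 3 ≤ p → paramSet k p i ⊆ F) :
    borelCommuting k p ⊆ F := by
  have : Infinite k := IsAlgClosed.instInfinite
  have main : ∀ d e : W k p, d ≠ 0 → (d, e) ∈ borelCommuting k p → (d, e) ∈ F := by
    intro d e hd hde
    obtain ⟨h1, -, h3⟩ := mem_borelCommuting.mp hde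
    classical
    have hex : ∃ n, d ∉ filtration k p (n : ℕ) := by
      refine ⟨p, fun h => hd (derivation_ext ?_)⟩
      rwa [mem_filtration_iff, pow_eq_zero_of_le p.le_succ x_pow_p, zero_dvd_iff] at h
    obtain ⟨i, hi⟩ : ∃ i, Nat.find hex = i + 1 := Nat.exists_eq_succ_of_ne_zero fun h => by
      have := Nat.find_spec hex
      rw [h] at this
      exact this (filtration_anti (Nat.zero_le 1) h1)
    have hi1 : d ∉ filtration k p (i + 1 : ℕ) := hi ▸ Nat.find_spec hex
    have hi2 : d ∈ filtration k p i := not_not.mp (Nat.find_min hex (by omega))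
    have h1i : 1 ≤ i := by
      by_contra! h
      exact hi1 (filtration_anti (by omega) h1)
    have hip : i + 2 ≤ p := by
      by_contra! h
      refine hd (derivation_ext ?_)
      rwa [mem_filtration_iff, pow_eq_zero_of_le (by omega) x_pow_p, zero_dvd_iff] at hi2
    obtain ⟨c, hc⟩ := exists_sub_smul_mem_of_lie_eq_zero hip hi2 hi1 h3
    by_cases hmid : 2 * i + 3 ≤ p
    · exact hPF i h1i hmid ⟨hi2, c, hc⟩
    -- From the middle on, `𝔤_i ⊆ 𝔤_{p-1-i}`, so `c • d` is absorbed and `e` itself lies in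
    -- `𝔤_{p-1-i}`.
    · have hodd : p % 2 = 1 := (Fact.out : p.Prime).eq_two_or_odd.resolve_left (by omega)
      refine mk_mem_of_paramSet_subset hF hp hPF hip (by omega) hi2 ?_
      have := add_mem hc (Submodule.smul_mem _ c
        (filtration_anti (i := p - 1 - i) (j := i) (by omega) hi2))
      simpa using this
  rintro ⟨d, e⟩ hde
  by_cases hd : d = 0
  · subst hd
    by_cases he : e = 0
    · subst he
      exact hPF 1 le_rfl (by have := (Fact.out : p.Prime).eq_two_or_odd; omega)
        ⟨zero_mem _, 0, by simp⟩
    -- The pair `(0, e)` is the limit of the commuting pairs `(t • e, e)`.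
    · refine mem_of_forall_ne_zero hF (u := (e, 0)) fun t ht => ?_
      have he1 := (mem_borelCommuting.mp hde).2.1
      have : (t • e, e) ∈ F := main _ _ (smul_ne_zero ht he)
        (mem_borelCommuting.mpr ⟨Submodule.smul_mem _ _ he1, he1, by simp⟩)
      simpa using this
  · exact main d e hd hde

theorem borelCommuting_eq_iUnion (hp : 3 < p) :
    borelCommuting k p = ⋃ i ∈ Icc 1 ((p - 3) / 2), frakC k p i := by
  refine Subset.antisymm (borelCommuting_subset ?_ hp fun i hi hi' => ?_)
    (iUnion₂_subset fun i hi => ?_)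
  · let _ := zariski k (W k p × W k p)
    exact (finite_Icc _ _).isClosed_biUnion fun i _ => isClosed_frakC i
  · exact (paramSet_subset_frakC hi (by omega)).trans
      (subset_biUnion_of_mem (u := frakC k p) (mem_Icc.mpr ⟨hi, by omega⟩))
  · have := mem_Icc.mp hi
    exact frakC_subset_borelCommuting this.1 (by omega)

/-- A closed set between `ℭ(i)` and `𝒞(𝔤₁)` has dimension `p`. -/
theorem zariskiDim_eq (hp : 3 < p) {i : ℕ} (hi : i ∈ Icc 1 ((p - 3) / 2))
    {Z : Set (W k p × W k p)} (hZ : IsClosed[zariski k _] Z) (hiZ : frakC k p i ⊆ Z)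
    (hZC : Z ⊆ borelCommuting k p) : zariskiDim k Z = p := by
  have : Infinite k := IsAlgClosed.instInfinite
  obtain ⟨hi1, hi2⟩ := mem_Icc.mp hi
  have hip : i + 2 ≤ p := by omega
  refine le_antisymm ?_ ?_
  · rw [borelCommuting_eq_iUnion hp] at hZC
    refine zariskiDim_le (finite_Icc _ _) (fun i _ => isClosed_frakC i) (fun j hj => ?_) hZ hZC
    have := mem_Icc.mp hj
    exact trdeg_coordRing_frakC_le this.1 (by omega)
  · let L := (filtration k p i).prod (filtration k p (p - 1 - i : ℕ))
    have hL : Module.finrank k L + 1 = p := by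
      have hrange : L = LinearMap.range ((filtration k p i).subtype.prodMap
          (filtration k p (p - 1 - i : ℕ)).subtype) := by
        rw [LinearMap.range_prodMap, Submodule.range_subtype, Submodule.range_subtype]
      rw [hrange, LinearMap.finrank_range_of_inj
        (Subtype.val_injective.prodMap Subtype.val_injective), Module.finrank_prod,
        finrank_filtration (by omega), finrank_filtration (by omega)]
      omega
    -- Strictness comes from the diagonal pair on `X ^ (i + 1) D`: its second entry is not in
    -- `𝔤_{p-1-i}`, as `i < p - 1 - i`.
    have hlt : (L : Set (W k p × W k p)) ⊂ frakC k p i := by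
      refine ⟨fun q hq => paramSet_subset_frakC hi1 hip ⟨hq.1, 0, by simpa using hq.2⟩, fun h => ?_⟩
      have hx : x k p ^ (i + 1) • D k p ∈ filtration k p i := x_pow_smul_D_mem_filtration le_rfl
      have := h (paramSet_subset_frakC hi1 hip (a := (x k p ^ (i + 1) • D k p,
        x k p ^ (i + 1) • D k p)) ⟨hx, 1, by simp⟩)
      exact x_pow_smul_D_notMem (k := k) hip (filtration_anti (by omega) this.2)
    have := le_zariskiDim L (isClosed_frakC i) (isIrreducible_frakC hi1 hip) hlt hiZ
    rwa [hL] at this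

end Components

end WittAlgebra

theorem theorem2 (k : Type*) [Field k] [IsAlgClosed k] (p : ℕ) [Fact p.Prime] [CharP k p]
    (hp : 3 < p) :
    WittAlgebra.nilpotentVariety (WittAlgebra.borel k p) =
      (WittAlgebra.filtration k p 1 : Set (WittAlgebra.W k p)) ∧
    (5 < p → ¬ WittAlgebra.ZariskiIrreducible k
      (WittAlgebra.commutingVariety (WittAlgebra.nilpotentVariety (WittAlgebra.borel k p)))) ∧
    (∀ T ∈ WittAlgebra.zariskiComponents k
      (WittAlgebra.commutingVariety (WittAlgebra.nilpotentVariety (WittAlgebra.borel k p))),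
      WittAlgebra.zariskiDim k T = (p : WithBot ℕ∞)) ∧
    WittAlgebra.commutingVariety (WittAlgebra.nilpotentVariety (WittAlgebra.borel k p)) =
      ⋃ i ∈ Set.Icc 1 ((p - 3) / 2), WittAlgebra.frakC k p i ∧
    WittAlgebra.zariskiComponents k
      (WittAlgebra.commutingVariety (WittAlgebra.nilpotentVariety (WittAlgebra.borel k p))) =
      WittAlgebra.frakC k p '' Set.Icc 1 ((p - 3) / 2) ∧
    Set.InjOn (WittAlgebra.frakC k p) (Set.Icc 1 ((p - 3) / 2)) ∧
    WittAlgebra.zariskiDim k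
      (WittAlgebra.commutingVariety (WittAlgebra.nilpotentVariety (WittAlgebra.borel k p))) =
      (p : WithBot ℕ∞) := by
  have hodd : p % 2 = 1 := (Fact.out : p.Prime).eq_two_or_odd.resolve_left (by omega)
  have hbound : ∀ i ∈ Set.Icc 1 ((p - 3) / 2), 1 ≤ i ∧ 2 * i + 3 ≤ p := fun i hi => by
    have := Set.mem_Icc.mp hi
    omega
  have hunion := WittAlgebra.borelCommuting_eq_iUnion (k := k) hp
  have hclosed := fun i (_ : i ∈ Set.Icc 1 ((p - 3) / 2)) =>
    WittAlgebra.isClosed_frakC (k := k) (p := p) i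
  have hirr := fun i (hi : i ∈ Set.Icc 1 ((p - 3) / 2)) =>
    WittAlgebra.isIrreducible_frakC (k := k) (p := p) (hbound i hi).1
      (by have := hbound i hi; omega)
  have hinj : ∀ i ∈ Set.Icc 1 ((p - 3) / 2), ∀ j ∈ Set.Icc 1 ((p - 3) / 2),
      WittAlgebra.frakC k p i ⊆ WittAlgebra.frakC k p j → i = j := fun i hi j hj =>
    WittAlgebra.eq_of_frakC_subset (hbound i hi).1 (hbound i hi).2 (hbound j hj).1 (hbound j hj).2
  have hcomp : WittAlgebra.zariskiComponents k (WittAlgebra.borelCommuting k p) =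
      WittAlgebra.frakC k p '' Set.Icc 1 ((p - 3) / 2) :=
    @WittAlgebra.image_irreducibleComponents_eq _ _
      (WittAlgebra.zariski k (WittAlgebra.W k p × WittAlgebra.W k p)) _ (Set.finite_Icc _ _) _
      hclosed hirr hinj _ hunion
  have hsub : ∀ i ∈ Set.Icc 1 ((p - 3) / 2),
      WittAlgebra.frakC k p i ⊆ WittAlgebra.borelCommuting k p := fun i hi =>
    WittAlgebra.frakC_subset_borelCommuting (hbound i hi).1 (by have := hbound i hi; omega)
  have h1 : 1 ∈ Set.Icc 1 ((p - 3) / 2) := Set.mem_Icc.mpr ⟨le_rfl, by omega⟩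
  refine ⟨WittAlgebra.nilpotentVariety_borel, fun h5 hC => ?_, fun T hT => ?_, hunion, hcomp,
    fun i hi j hj h => hinj i hi j hj h.subset, ?_⟩
  -- For `p > 5` the indices `1` and `2` both occur; were the variety irreducible, a single `ℭ(i)`
  -- would contain both `ℭ(1)` and `ℭ(2)`.
  · have h2 : 2 ∈ Set.Icc 1 ((p - 3) / 2) := Set.mem_Icc.mpr ⟨by omega, by omega⟩
    obtain ⟨i, hi, h⟩ := @WittAlgebra.exists_subset_of_isIrreducible _ _
      (WittAlgebra.zariski k (WittAlgebra.W k p × WittAlgebra.W k p)) _ hC _ (Set.finite_Icc _ _) _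
      hclosed hunion.subset
    have e1 := hinj 1 h1 i hi ((hsub 1 h1).trans h)
    have e2 := hinj 2 h2 i hi ((hsub 2 h2).trans h)
    omega
  · rw [hcomp] at hT
    obtain ⟨i, hi, rfl⟩ := hT
    exact WittAlgebra.zariskiDim_eq hp hi (hclosed i hi) subset_rfl (hsub i hi)
  · exact WittAlgebra.zariskiDim_eq hp h1 WittAlgebra.isClosed_borelCommuting (hsub 1 h1) subset_rfl
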